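/- Let $\mathbb{F}_q$ be the finite field with $q$ elements, let $1<s<r$ and $d\ge 2$ be integers, and let $\mathcal{F}_d$ be the set of polynomials in $\mathbb{F}_q[X_1,\ldots,X_r]$ of total degree at most $d$ (including the zero polynomial). For $m\in\mathbb{N}$ put $\mu_m:=\sum_{j=1}^m\frac{(-1)^{j-1}}{j!}$. For an integer $h$ with $1<h\le r-s+1$, let $\mathbb{F}_{(h)}$ be the set of $h$-tuples $\underline{a}=(a_1,\ldots,a_h)$ of pairwise distinct elements of $\mathbb{F}_q^{\,r-s}$, and endow $\mathbb{F}_{(h)}\times\mathcal{F}_d^{\,s}$ with the uniform probability $P_h$. For $\underline{a}\in\mathbb{F}_{(h)}$ and $F=(F_1,\ldots,F_s)\in\mathcal{F}_d^{\,s}$, let $C_h(\underline{a},F)\in\{1,\ldots,h,\infty\}$ be the least $j$ such that the specialized system $F_1(a_j,X_{r-s+1},\ldots,X_r)=\cdots=F_s(a_j,X_{r-s+1},\ldots,X_r)=0$ has a solution in $\mathbb{F}_q^{\,s}$ (that is, the system $F=0$ has an $\mathbb{F}_q$-rational solution in the vertical strip $\{a_j\}\times\mathbb{F}_q^{\,s}$),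 and $C_h(\underline{a},F)=\infty$ if there is no such $j$. Assume that $q^s>\max\{d,6\}$. Then $$\big|P_h[C_h=h]-\mu_d(1-\mu_d)^{h-1}\big|\le \frac{1}{(d+1)!}\Big(e^{h-1}+\frac12\Big)+\frac{2}{q}+\frac{5}{q^s}(2-\mu_d)^{h-1}\quad\text{if } d \text{ is odd},$$ $$\big|P_h[C_h=h]-\mu_{d+1}(1-\mu_{d+1})^{h-1}\big|\le \frac{1}{(d+1)!}\Big(e^{h-1}+\frac12\Big)+\frac{2}{q}+\frac{5}{q^s}(2-\mu_d)^{h-1}\quad\text{if } d \text{ is even}.$$ -/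

import Mathlib

open scoped Nat

noncomputable section

namespace VerticalStrips

/-- `μ_m = ∑_{j=1}^m (-1)^{j-1} / j!`. -/
def mu (m : ℕ) : ℝ := ∑ j ∈ Finset.Icc 1 m, (-1 : ℝ) ^ (j - 1) / (j ! : ℝ)

/-- The space `F_d` of polynomials in `K[X_1, …, X_r]` of total degree at most `d`
(the zero polynomial included). -/
abbrev PolyDeg (K : Type*) [Field K] (r d : ℕ) : Type _ :=
  MvPolynomial.restrictTotalDegree (Fin r) K d

instance instFinitePolyDeg (K : Type*) [Field K] [Finite K] (r d : ℕ) :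
    Finite (PolyDeg K r d) := by
  have hfin : {n : Fin r →₀ ℕ | n.degree ≤ d}.Finite := by
    refine (Set.finite_Iic (Finsupp.equivFunOnFinite.symm fun _ : Fin r => d)).subset ?_
    intro n hn i
    exact (Finsupp.le_degree i n).trans hn
  have : Finite {n : Fin r →₀ ℕ | n.degree ≤ d} := hfin
  have : Module.Finite K (PolyDeg K r d) :=
    Module.Finite.of_basis (MvPolynomial.basisRestrictSupport K {n : Fin r →₀ ℕ | n.degree ≤ d})
  exact Module.finite_of_finite K

/-- The specialization `F(a, -) ∈ K[X_{r-s+1}, …, X_r]`: the first `r - s` variables are replaced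
by the coordinates of `a`, and the last `s` variables are kept (indexed by `Fin s`). -/
def specialize {K : Type*} [Field K] {r s : ℕ} (a : Fin (r - s) → K)
    (F : MvPolynomial (Fin r) K) : MvPolynomial (Fin s) K :=
  MvPolynomial.aeval
    (fun i : Fin r =>
      if hi : i.val < r - s then MvPolynomial.C (a ⟨i.val, hi⟩)
      else MvPolynomial.X ⟨i.val - (r - s), by omega⟩) F

/-- `Z(G)`: the number of common zeros with coordinates in `K` of a system `G` of `s`
polynomials in `s` variables. -/
def numZeros {K : Type*} [Field K] {s : ℕ} (G : Fin s → MvPolynomial (Fin s) K) : ℕ :=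
  Nat.card {x : Fin s → K // ∀ k, MvPolynomial.eval x (G k) = 0}

/-- The sample space: `h`-tuples of pairwise distinct elements `a_1, …, a_h` of `K^{r-s}`,
together with a system of `s` polynomials of degree at most `d` in `r` variables. -/
abbrev Sample (K : Type*) [Field K] (r s d h : ℕ) : Type _ :=
  (Fin h ↪ (Fin (r - s) → K)) × (Fin s → PolyDeg K r d)

/-- The random variable `C_h`: the least `j ∈ {1, …, h}` such that the vertical strip
`{a_j} × K^s` contains a `K`-rational solution of the system, and `∞` if there is none. -/
def searchCount {K : Type*} [Field K] {r s d h : ℕ} (ω : Sample K r s d h) : ℕ∞ :=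
  sInf {n : ℕ∞ | ∃ j : Fin h, n = ((j.val + 1 : ℕ) : ℕ∞) ∧
    0 < numZeros (fun k => specialize (ω.1 j) (ω.2 k : MvPolynomial (Fin r) K))}

/-- The uniform probability of an event in a finite sample space. -/
def uniformProb {Ω : Type*} [Finite Ω] (E : Set Ω) : ℝ :=
  (E.ncard : ℝ) / (Nat.card Ω : ℝ)

end VerticalStrips

end

/-! Write h = m + 1 and Q = q^s. Fix the strips and suppose that affine functions take arbitrary
values on them. Then polynomials of degree at most d interpolate arbitrary data at d + 1 points of
one strip and d points of each other strip. Evaluation at such points is therefore a surjective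
linear map, and the events "F vanishes at this point" are independent of probability 1/Q
(`stripIndep_of_generalPosition`). So the joint binomial moments of the zero counts N_i factor as
products of C(Q,j)/Q^j, as long as only one index exceeds d, and that one equals d + 1.

The indicator of N = 0 is replaced by the truncated inclusion-exclusion sum, with error at most
C(N,d+1). In a product over strips, telescoping leaves one such error at a time, multiplied by
majorants of binomial degree at most d, so every expectation needed is still computable. Each strip
costs at most 1/(d+1)! (`abs_count_event_sub_le`). The resulting main term p^m(1 - p) is compared
with p = 1 - μ through C(Q,j)/Q^j ≈ 1/j!, at cost 5/Q.

Finally, all but a proportion 2/q of the tuples of strips are affinely independent, and an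
exceptional tuple costs at most 1 (`card_mul_le_card_goodTuples`, `abs_uniformProb_sub_le`). -/

noncomputable section

namespace VerticalStrips

/-! ### Truncated inclusion-exclusion -/

/-- The truncated alternating sum of binomial coefficients `∑_{j ≤ d} (-1)^j C(N, j)`. -/
def altChoose (d N : ℕ) : ℝ := ∑ j ∈ Finset.range (d + 1), (-1 : ℝ) ^ j * (N.choose j : ℝ)

lemma altChoose_zero (d : ℕ) : altChoose d 0 = 1 := by
  simp [altChoose, Finset.sum_range_succ']

/-- Pascal's rule makes the sum telescope. This closed form yields both the truncation error and the
majorant below. -/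
lemma altChoose_succ (d n : ℕ) : altChoose d (n + 1) = (-1) ^ d * (n.choose d : ℝ) := by
  induction d with
  | zero => simp [altChoose]
  | succ d ih =>
    rw [altChoose, Finset.sum_range_succ]
    rw [altChoose] at ih
    rw [ih, Nat.choose_succ_succ]
    push_cast
    ring

/-- The indicator of `N = 0`. -/
def indZero (N : ℕ) : ℝ := if N = 0 then 1 else 0

/-- A polynomial majorant of both `indZero` and `|altChoose d|`. -/
def majorant (d N : ℕ) : ℝ := 1 - N + N.choose 2 + N.choose d

lemma abs_indZero_sub_altChoose (d N : ℕ) :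
    |indZero N - altChoose d N| ≤ (N.choose (d + 1) : ℝ) := by
  cases N with
  | zero => simp [indZero, altChoose_zero]
  | succ n =>
    simp only [indZero, altChoose_succ, Nat.succ_ne_zero, if_false, zero_sub, abs_neg, abs_mul,
      abs_pow, abs_one, one_pow, one_mul, Nat.abs_cast]
    rw [Nat.choose_succ_succ]
    push_cast
    linarith [Nat.cast_nonneg (α := ℝ) (n.choose (d + 1))]

lemma majorant_succ (d n : ℕ) :
    majorant d (n + 1) = n.choose 2 + (n + 1).choose d := by
  have : (n + 1).choose 2 = n + n.choose 2 := by
    rw [Nat.choose_succ_succ, Nat.choose_one_right]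
  rw [majorant, this]
  push_cast
  ring

lemma abs_altChoose_le (d N : ℕ) : |altChoose d N| ≤ majorant d N := by
  cases N with
  | zero => simp [altChoose_zero, majorant]
  | succ n =>
    rw [altChoose_succ, majorant_succ, abs_mul, abs_pow, abs_neg, abs_one, one_pow, one_mul,
      Nat.abs_cast]
    have : (n.choose d : ℝ) ≤ (n + 1).choose d := by
      exact_mod_cast Nat.choose_le_choose d (Nat.le_succ n)
    linarith [Nat.cast_nonneg (α := ℝ) (n.choose 2)]

lemma abs_indZero_le (d N : ℕ) : |indZero N| ≤ majorant d N := by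
  cases N with
  | zero => simp [indZero, majorant]
  | succ n =>
    rw [majorant_succ]
    simp only [indZero, Nat.succ_ne_zero, if_false, abs_zero]
    positivity

/-- Factors are exchanged one at a time. Each term has a single error factor `D`, which fits
independence with one exceptional strip. -/
lemma abs_prod_sub_prod_le {ι : Type*} [DecidableEq ι] (S : Finset ι) (f g D W : ι → ℝ)
    (hf : ∀ i, |f i| ≤ W i) (hg : ∀ i, |g i| ≤ W i) (hD : ∀ i, |f i - g i| ≤ D i) :
    |∏ i ∈ S, f i - ∏ i ∈ S, g i| ≤ ∑ i ∈ S, D i * ∏ j ∈ S.erase i, W j := by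
  have hW : ∀ i, 0 ≤ W i := fun i => (abs_nonneg _).trans (hf i)
  have hD0 : ∀ i, 0 ≤ D i := fun i => (abs_nonneg _).trans (hD i)
  induction S using Finset.induction_on with
  | empty => simp
  | insert a S ha ih =>
    rw [Finset.prod_insert ha, Finset.prod_insert ha, Finset.sum_insert ha,
      Finset.erase_insert ha]
    have h1 : f a * ∏ i ∈ S, f i - g a * ∏ i ∈ S, g i =
        (f a - g a) * ∏ i ∈ S, f i + g a * (∏ i ∈ S, f i - ∏ i ∈ S, g i) := by ring
    have h2 : ∑ i ∈ S, D i * ∏ j ∈ (insert a S).erase i, W j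
        = W a * ∑ i ∈ S, D i * ∏ j ∈ S.erase i, W j := by
      rw [Finset.mul_sum]
      refine Finset.sum_congr rfl fun i hi => ?_
      have hia : a ≠ i := fun h => ha (h ▸ hi)
      rw [Finset.erase_insert_of_ne hia, Finset.prod_insert (fun h => ha (Finset.mem_of_mem_erase h))]
      ring
    rw [h1, h2]
    refine (abs_add_le _ _).trans ?_
    rw [abs_mul, abs_mul, Finset.abs_prod]
    refine add_le_add ?_ ?_
    · exact mul_le_mul (hD a) (Finset.prod_le_prod (fun i _ => abs_nonneg _) fun i _ => hf i)
        (Finset.prod_nonneg fun i _ => abs_nonneg _) (hD0 a)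
    · exact mul_le_mul (hg a) ih (abs_nonneg _) (hW a)

/-! ### Elementary estimates -/

lemma alternating_sum_mem_Icc (t : ℕ → ℝ) (ht : Antitone t) (h0 : ∀ n, 0 ≤ t n) (n : ℕ) :
    0 ≤ ∑ j ∈ Finset.range n, (-1 : ℝ) ^ j * t j ∧
      ∑ j ∈ Finset.range n, (-1 : ℝ) ^ j * t j ≤ t 0 := by
  induction n generalizing t with
  | zero => simpa using h0 0
  | succ n ih =>
    have h := ih (fun j => t (j + 1)) (fun a b hab => ht (by omega)) (fun n => h0 _)
    have : ∑ j ∈ Finset.range (n + 1), (-1 : ℝ) ^ j * t j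
        = t 0 - ∑ j ∈ Finset.range n, (-1 : ℝ) ^ j * t (j + 1) := by
      rw [Finset.sum_range_succ', sub_eq_add_neg, ← Finset.sum_neg_distrib, add_comm]
      simp [pow_succ]
    rw [this]
    have h10 : t (0 + 1) ≤ t 0 := ht (by omega)
    constructor
    · linarith [h.2]
    · linarith [h.1]

/-- For y ≤ x the difference is (x^n - y^n)(1 - x) - y^n (x - y). The first part is at most x - y
because (1 + x + ⋯ + x^(n-1))(1 - x) ≤ 1. Thus the main term is 1-Lipschitz, uniformly in the number
of strips. -/
lemma abs_pow_mul_one_sub_sub_le (n : ℕ) {x y : ℝ} (hx0 : 0 ≤ x) (hx1 : x ≤ 1) (hy0 : 0 ≤ y)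
    (hy1 : y ≤ 1) : |x ^ n * (1 - x) - y ^ n * (1 - y)| ≤ |x - y| := by
  wlog hyx : y ≤ x generalizing x y
  · rw [abs_sub_comm, abs_sub_comm x y]
    exact this hy0 hy1 hx0 hx1 (le_of_not_ge hyx)
  rw [abs_of_nonneg (sub_nonneg.2 hyx), abs_le]
  have hyn : y ^ n ≤ x ^ n := pow_le_pow_left₀ hy0 hyx n
  have hxn : x ^ n ≤ 1 := pow_le_one₀ hx0 hx1
  have hyn0 : 0 ≤ y ^ n := pow_nonneg hy0 n
  constructor
  · nlinarith
  · have hgeom : (∑ i ∈ Finset.range n, x ^ i * y ^ (n - 1 - i)) * (x - y) = x ^ n - y ^ n :=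
      Commute.geom_sum₂_mul (Commute.all x y) n
    have hgeom' : (∑ i ∈ Finset.range n, x ^ i) * (x - 1) = x ^ n - 1 := geom_sum_mul x n
    have hle : ∑ i ∈ Finset.range n, x ^ i * y ^ (n - 1 - i) ≤ ∑ i ∈ Finset.range n, x ^ i :=
      Finset.sum_le_sum fun i _ => mul_le_of_le_one_right (pow_nonneg hx0 i) (pow_le_one₀ hy0 hy1)
    have h1 : (∑ i ∈ Finset.range n, x ^ i * y ^ (n - 1 - i)) * (1 - x) ≤ 1 := by
      have := mul_le_mul_of_nonneg_right hle (sub_nonneg.2 hx1)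
      have := pow_nonneg hx0 n
      linarith
    have h2 := mul_le_mul_of_nonneg_right h1 (sub_nonneg.2 hyx)
    have h3 : 0 ≤ y ^ n * (x - y) := mul_nonneg hyn0 (sub_nonneg.2 hyx)
    have h4 : (x ^ n - y ^ n) * (1 - x) ≤ x - y := by
      rw [← hgeom]
      linarith
    nlinarith

/-- `C(Q, j) / Q ^ j`, the `j`-th binomial moment of the number of zeros in a strip with
`Q` points. -/
def binomMoment (Q j : ℕ) : ℝ := (Q.choose j : ℝ) / (Q : ℝ) ^ j

lemma binomMoment_nonneg (Q j : ℕ) : 0 ≤ binomMoment Q j := by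
  unfold binomMoment; positivity

lemma binomMoment_zero (Q : ℕ) : binomMoment Q 0 = 1 := by simp [binomMoment]

lemma binomMoment_one {Q : ℕ} (hQ : 0 < Q) : binomMoment Q 1 = 1 := by
  have : (Q : ℝ) ≠ 0 := by positivity
  simp [binomMoment, this]

lemma binomMoment_le (Q j : ℕ) : binomMoment Q j ≤ 1 / (j ! : ℝ) := by
  rcases Nat.eq_zero_or_pos Q with rfl | hQ
  · rcases j with _ | j
    · simp [binomMoment]
    · simp [binomMoment]
  · rw [binomMoment, div_le_iff₀ (by positivity)]
    have := Nat.choose_le_pow_div (α := ℝ) j Q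
    rw [div_mul_eq_mul_div, one_mul]
    exact this

lemma binomMoment_succ {Q : ℕ} (hQ : 0 < Q) (j : ℕ) :
    binomMoment Q (j + 1) * ((j : ℝ) + 1) * Q = binomMoment Q j * ((Q : ℝ) - j) := by
  have hQ' : (Q : ℝ) ≠ 0 := by positivity
  have h : ((Q.choose (j + 1) : ℕ) : ℝ) * ((j : ℝ) + 1) = (Q.choose j : ℝ) * ((Q : ℝ) - j) := by
    rcases le_or_gt j Q with hj | hj
    · have := Nat.choose_succ_right_eq Q j
      have h2 := congrArg (Nat.cast (R := ℝ)) this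
      push_cast [Nat.cast_sub hj] at h2
      exact h2
    · rw [Nat.choose_eq_zero_of_lt hj, Nat.choose_eq_zero_of_lt (by omega)]
      simp
  unfold binomMoment
  field_simp
  rw [pow_succ]
  linear_combination (Q : ℝ) ^ j * Q * h

lemma binomMoment_antitone {Q : ℕ} (hQ : 0 < Q) : Antitone (binomMoment Q) := by
  refine antitone_nat_of_succ_le fun j => ?_
  have h := binomMoment_succ hQ j
  have h0 := binomMoment_nonneg Q j
  have h1 := binomMoment_nonneg Q (j + 1)
  have hQ' : (0 : ℝ) < Q := by positivity
  have hj : (0 : ℝ) ≤ j := by positivity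
  refine le_of_mul_le_mul_right ?_ hQ'
  have : 0 ≤ binomMoment Q (j + 1) * j * Q := by positivity
  have : 0 ≤ binomMoment Q j * j := by positivity
  linarith

/-- The deviation of the binomial moment from that of a Poisson variable. -/
lemma one_div_factorial_sub_binomMoment_le {Q : ℕ} (hQ : 0 < Q) (j : ℕ) :
    1 / (j ! : ℝ) - binomMoment Q j ≤ (j * (j - 1) : ℝ) / 2 / Q / (j ! : ℝ) := by
  have hQ' : (0 : ℝ) < Q := by positivity
  -- The quantity j! C(Q,j)/Q^j is the product of the 1 - i/Q for i < j, hence at least 1 - (0 + 1 +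
  -- ⋯ + (j-1))/Q.
  have key : 1 - (j ! : ℝ) * binomMoment Q j ≤ (j * (j - 1) : ℝ) / 2 / Q := by
    induction j with
    | zero => simp [binomMoment_zero]
    | succ j ih =>
      have h := binomMoment_succ hQ j
      have hle : (j ! : ℝ) * binomMoment Q j ≤ 1 := by
        have := binomMoment_le Q j
        rw [le_div_iff₀ (by positivity)] at this
        linarith
      have e : (((j + 1)! : ℕ) : ℝ) * binomMoment Q (j + 1)
          = (j ! : ℝ) * binomMoment Q j - (j ! : ℝ) * binomMoment Q j * j / Q := by
        rw [Nat.factorial_succ]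
        push_cast
        field_simp
        linear_combination h
      rw [e]
      have : (j ! : ℝ) * binomMoment Q j * j / Q ≤ 1 * j / Q := by gcongr
      have e2 : (((j + 1 : ℕ) : ℝ) * (((j + 1 : ℕ) : ℝ) - 1)) / 2 / Q
          = (j * (j - 1) : ℝ) / 2 / Q + 1 * j / Q := by
        push_cast
        field_simp
        ring
      rw [e2]
      linarith
  have hj : (0 : ℝ) < (j ! : ℝ) := by positivity
  rw [le_div_iff₀ hj, sub_mul, one_div_mul_cancel hj.ne']
  linarith

/-! ### Partial sums of the series for 1/e and their finite-Q analogue. -/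

lemma mu_succ (m : ℕ) : mu (m + 1) = mu m + (-1 : ℝ) ^ m / ((m + 1)! : ℝ) := by
  rw [mu, Finset.sum_Icc_succ_top (by omega), mu, Nat.add_sub_cancel]

lemma one_sub_mu (m : ℕ) :
    1 - mu m = ∑ j ∈ Finset.range (m + 1), (-1 : ℝ) ^ j * (1 / (j ! : ℝ)) := by
  induction m with
  | zero => simp [mu]
  | succ m ih =>
    rw [Finset.sum_range_succ, ← ih, mu_succ, pow_succ]
    ring

lemma one_sub_mu_mem_Icc (m : ℕ) : 0 ≤ 1 - mu m ∧ 1 - mu m ≤ 1 := by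
  rw [one_sub_mu]
  have := alternating_sum_mem_Icc (fun j => 1 / (j ! : ℝ)) (fun a b hab => by
    have : (a ! : ℝ) ≤ b ! := by exact_mod_cast Nat.factorial_le hab
    dsimp only
    gcongr) (fun n => by positivity) (m + 1)
  simpa using this

/-- The expected value of `altChoose d` for a strip with `Q` points. -/
def altMoment (Q d : ℕ) : ℝ := ∑ j ∈ Finset.range (d + 1), (-1 : ℝ) ^ j * binomMoment Q j

lemma altMoment_mem_Icc {Q : ℕ} (hQ : 0 < Q) (d : ℕ) :
    0 ≤ altMoment Q d ∧ altMoment Q d ≤ 1 := by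
  have := alternating_sum_mem_Icc _ (binomMoment_antitone hQ) (binomMoment_nonneg Q) (d + 1)
  rwa [binomMoment_zero] at this

lemma abs_altMoment_sub_le {Q : ℕ} (hQ : 0 < Q) (d : ℕ) :
    |altMoment Q d - (1 - mu d)| ≤ 5 / Q := by
  have hQ' : (0 : ℝ) < Q := by positivity
  have hterm : ∀ j, |(-1 : ℝ) ^ j * binomMoment Q j - (-1 : ℝ) ^ j * (1 / (j ! : ℝ))|
      ≤ (j * (j - 1) : ℝ) / 2 / Q / (j ! : ℝ) := fun j => by
    rw [← mul_sub, abs_mul, abs_pow, abs_neg, abs_one, one_pow, one_mul, abs_sub_comm,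
      abs_of_nonneg (sub_nonneg.2 (binomMoment_le Q j))]
    exact one_div_factorial_sub_binomMoment_le hQ j
  -- Two extra terms are added because j(j-1)/j! vanishes for j = 0, 1 and equals 1/(j-2)!
  -- afterwards. The sum becomes a partial sum for e, divided by 2Q.
  have hsum : ∑ j ∈ Finset.range (d + 1), (j * (j - 1) : ℝ) / 2 / Q / (j ! : ℝ)
      ≤ ∑ j ∈ Finset.range (d + 1 + 2), (j * (j - 1) : ℝ) / 2 / Q / (j ! : ℝ) := by
    refine Finset.sum_le_sum_of_subset_of_nonneg
      (Finset.range_mono (by omega)) fun j _ _ => ?_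
    have : (0 : ℝ) ≤ j * (j - 1) := by
      rcases j with _ | j
      · simp
      · push_cast
        have : (0 : ℝ) ≤ j := by positivity
        nlinarith
    positivity
  have hshift : ∑ j ∈ Finset.range (d + 1 + 2), (j * (j - 1) : ℝ) / 2 / Q / (j ! : ℝ)
      = (∑ j ∈ Finset.range (d + 1), (1 : ℝ) ^ j / (j ! : ℝ)) / (2 * Q) := by
    rw [Finset.sum_range_succ', Finset.sum_range_succ', Finset.sum_div]
    simp only [Nat.cast_zero, zero_mul, zero_div, add_zero, zero_add, Nat.cast_one, sub_self,
      mul_zero]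
    refine Finset.sum_congr rfl fun j _ => ?_
    rw [Nat.factorial_succ, Nat.factorial_succ]
    push_cast
    field_simp
    ring
  have hexp := Real.sum_le_exp_of_nonneg (zero_le_one' ℝ) (d + 1)
  have he := Real.exp_one_lt_d9
  rw [one_sub_mu, altMoment, ← Finset.sum_sub_distrib]
  refine (Finset.abs_sum_le_sum_abs _ _).trans ((Finset.sum_le_sum fun j _ => hterm j).trans ?_)
  refine hsum.trans ?_
  rw [hshift, div_le_div_iff₀ (by positivity) hQ']
  nlinarith

/-- Absorbs the n + 2 errors of size 1/(d+1)! into e^n + 1/2. The base case is e ≥ 5/2. -/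
lemma add_three_halves_le_exp_pow {n : ℕ} (hn : 1 ≤ n) :
    (n : ℝ) + 3 / 2 ≤ Real.exp 1 ^ n := by
  have he := Real.exp_one_gt_d9
  induction n, hn using Nat.le_induction with
  | base => norm_num; linarith
  | succ n hn ih =>
    rw [pow_succ]
    have : (0 : ℝ) ≤ n := by positivity
    push_cast
    nlinarith

/-! ### Factorization of joint binomial moments -/

open Classical in
/-- The number of points `x` such that `Z x` holds. -/
def count {X : Type*} [Fintype X] (Z : X → Prop) : ℕ := (Finset.univ.filter Z).card

/-- The function `N ↦ ∑_{j ≤ d + 1} c_j C(N, j)`. -/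
def binomEval (d : ℕ) (c : ℕ → ℝ) (N : ℕ) : ℝ :=
  ∑ j ∈ Finset.range (d + 2), c j * (N.choose j : ℝ)

/-- The expectation of `binomEval d c` for a strip with `Q` points. -/
def binomExpect (Q d : ℕ) (c : ℕ → ℝ) : ℝ :=
  ∑ j ∈ Finset.range (d + 2), c j * binomMoment Q j

/-- The random conditions `Z i x` are independent, with probability `1 / |X|` each, as long as at
most `d` of them are taken for each index `i`, with the exception of one index for which `d + 1`
conditions are allowed. -/
def StripIndep {ι X Ω : Type*} [Fintype ι] [Fintype X] [Fintype Ω] (d : ℕ)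
    (Z : ι → X → Ω → Prop) : Prop :=
  ∀ (i₀ : ι) (T : ι → Finset X), (T i₀).card ≤ d + 1 → (∀ i, i ≠ i₀ → (T i).card ≤ d) →
    count (fun ω => ∀ i, ∀ x ∈ T i, Z i x ω) * Fintype.card X ^ (∑ i, (T i).card)
      = Fintype.card Ω

open Classical in
lemma choose_count {X : Type*} [Fintype X] (Z : X → Prop) (j : ℕ) :
    ((count Z).choose j : ℝ)
      = ∑ T ∈ (Finset.univ : Finset X).powersetCard j, if ∀ x ∈ T, Z x then (1 : ℝ) else 0 := by
  rw [count, ← Finset.card_powersetCard, Finset.sum_boole]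
  congr 2
  ext T
  simp only [Finset.mem_powersetCard, Finset.mem_filter, true_and, Finset.subset_iff,
    Finset.mem_univ]
  tauto

section

variable {ι X Ω : Type*} [Fintype ι] [Fintype X] [Nonempty X] [Fintype Ω] {d : ℕ}
  {Z : ι → X → Ω → Prop}

/-- A product of binomial coefficients counts families of J i-subsets of the zero sets. After
exchanging sums, independence gives every family the same weight. -/
lemma sum_prod_choose_count (hZ : StripIndep d Z) (i₀ : ι) (J : ι → ℕ) (h₀ : J i₀ ≤ d + 1)
    (hJ : ∀ i, i ≠ i₀ → J i ≤ d) :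
    ∑ ω, ∏ i, ((count fun x => Z i x ω).choose (J i) : ℝ)
      = Fintype.card Ω * ∏ i, binomMoment (Fintype.card X) (J i) := by
  classical
  have hX : (Fintype.card X : ℝ) ≠ 0 := by
    exact_mod_cast Fintype.card_ne_zero
  have h1 : ∀ ω, ∏ i, ((count fun x => Z i x ω).choose (J i) : ℝ)
      = ∑ T ∈ Fintype.piFinset fun i => (Finset.univ : Finset X).powersetCard (J i),
          if ∀ i, ∀ x ∈ T i, Z i x ω then (1 : ℝ) else 0 := by
    intro ω
    simp_rw [choose_count]
    rw [Finset.prod_univ_sum]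
    refine Finset.sum_congr rfl fun T _ => ?_
    rw [Finset.prod_ite_zero]
    simp
  simp_rw [h1]
  rw [Finset.sum_comm]
  have h2 : ∀ T ∈ Fintype.piFinset fun i => (Finset.univ : Finset X).powersetCard (J i),
      ∑ ω, (if ∀ i, ∀ x ∈ T i, Z i x ω then (1 : ℝ) else 0)
        = Fintype.card Ω / (Fintype.card X : ℝ) ^ (∑ i, J i) := by
    intro T hT
    have hc : ∀ i, (T i).card = J i := fun i =>
      (Finset.mem_powersetCard.1 (Fintype.mem_piFinset.1 hT i)).2
    have := hZ i₀ T (by rw [hc]; exact h₀) fun i hi => by rw [hc]; exact hJ i hi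
    simp_rw [hc] at this
    rw [Finset.sum_boole, eq_div_iff (pow_ne_zero _ hX), ← this, count]
    push_cast
    congr!
  rw [Finset.sum_congr rfl h2, Finset.sum_const, Fintype.card_piFinset]
  simp only [Finset.card_powersetCard, Finset.card_univ, binomMoment, nsmul_eq_mul,
    Finset.prod_div_distrib, Finset.prod_pow_eq_pow_sum]
  push_cast
  ring

lemma sum_prod_binomEval (hZ : StripIndep d Z) (i₀ : ι) (c : ι → ℕ → ℝ)
    (hc : ∀ i, i ≠ i₀ → c i (d + 1) = 0) :
    ∑ ω, ∏ i, binomEval d (c i) (count fun x => Z i x ω)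
      = Fintype.card Ω * ∏ i, binomExpect (Fintype.card X) d (c i) := by
  classical
  simp_rw [binomEval, binomExpect, Finset.prod_univ_sum]
  rw [Finset.sum_comm, Finset.mul_sum]
  refine Finset.sum_congr rfl fun J hJ => ?_
  simp_rw [Finset.prod_mul_distrib]
  rw [← Finset.mul_sum]
  have hJ' : ∀ i, J i < d + 2 := fun i => Finset.mem_range.1 (Fintype.mem_piFinset.1 hJ i)
  by_cases h : ∃ i, i ≠ i₀ ∧ J i = d + 1
  · obtain ⟨i, hi, hi'⟩ := h
    have : ∏ i, c i (J i) = 0 :=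
      Finset.prod_eq_zero (Finset.mem_univ i) (by rw [hi', hc i hi])
    rw [this]
    simp
  · push Not at h
    rw [sum_prod_choose_count hZ i₀ J (by have := hJ' i₀; omega)
      fun i hi => by have := hJ' i; have := h i hi; omega]
    ring

end

/-! ### Coefficient sequences -/

lemma sum_range_ite_eq {d k : ℕ} (hk : k < d + 2) (f : ℕ → ℝ) :
    ∑ j ∈ Finset.range (d + 2), (if j = k then (1 : ℝ) else 0) * f j = f k := by
  simp [hk]

/-- Coefficients of `altChoose d`. -/
def altCoeff (d j : ℕ) : ℝ := if j ≤ d then (-1) ^ j else 0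

/-- Coefficients of the `k`-th binomial coefficient. -/
def unitCoeff (k j : ℕ) : ℝ := if j = k then 1 else 0

/-- Coefficients of `majorant d`. -/
def majCoeff (d j : ℕ) : ℝ := unitCoeff 0 j - unitCoeff 1 j + unitCoeff 2 j + unitCoeff d j

lemma sum_altCoeff (d : ℕ) (f : ℕ → ℝ) :
    ∑ j ∈ Finset.range (d + 2), altCoeff d j * f j
      = ∑ j ∈ Finset.range (d + 1), (-1 : ℝ) ^ j * f j := by
  rw [Finset.sum_range_succ]
  simp only [altCoeff, show ¬ d + 1 ≤ d by omega, if_false, zero_mul, add_zero]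
  refine Finset.sum_congr rfl fun j hj => ?_
  rw [if_pos (by have := Finset.mem_range.1 hj; omega)]

lemma sum_unitCoeff {d k : ℕ} (hk : k < d + 2) (f : ℕ → ℝ) :
    ∑ j ∈ Finset.range (d + 2), unitCoeff k j * f j = f k :=
  sum_range_ite_eq hk f

lemma sum_majCoeff {d : ℕ} (hd : 2 ≤ d) (f : ℕ → ℝ) :
    ∑ j ∈ Finset.range (d + 2), majCoeff d j * f j = f 0 - f 1 + f 2 + f d := by
  simp only [majCoeff, add_mul, sub_mul, Finset.sum_add_distrib, Finset.sum_sub_distrib]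
  rw [sum_unitCoeff (by omega), sum_unitCoeff (by omega), sum_unitCoeff (by omega),
    sum_unitCoeff (by omega)]

lemma binomEval_altCoeff (d N : ℕ) : binomEval d (altCoeff d) N = altChoose d N :=
  sum_altCoeff d _

lemma binomExpect_altCoeff (Q d : ℕ) : binomExpect Q d (altCoeff d) = altMoment Q d :=
  sum_altCoeff d _

lemma binomEval_unitCoeff {d k : ℕ} (hk : k < d + 2) (N : ℕ) :
    binomEval d (unitCoeff k) N = N.choose k :=
  sum_unitCoeff hk _

lemma binomExpect_unitCoeff {d k : ℕ} (hk : k < d + 2) (Q : ℕ) :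
    binomExpect Q d (unitCoeff k) = binomMoment Q k :=
  sum_unitCoeff hk _

lemma binomEval_majCoeff {d : ℕ} (hd : 2 ≤ d) (N : ℕ) :
    binomEval d (majCoeff d) N = majorant d N := by
  rw [binomEval, sum_majCoeff hd, majorant]
  simp

/-- The terms 1 - N cancel in expectation, and the moments of order 2 and d are at most 1/2 each.
Hence products of majorants cost nothing, whatever the number of strips. -/
lemma binomExpect_majCoeff_mem_Icc {Q d : ℕ} (hQ : 0 < Q) (hd : 2 ≤ d) :
    0 ≤ binomExpect Q d (majCoeff d) ∧ binomExpect Q d (majCoeff d) ≤ 1 := by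
  rw [binomExpect, sum_majCoeff hd, binomMoment_zero, binomMoment_one hQ]
  have h2 := binomMoment_le Q 2
  have h := binomMoment_antitone hQ hd
  have h0 := binomMoment_nonneg Q 2
  have h0' := binomMoment_nonneg Q d
  norm_num at h2
  constructor <;> linarith

lemma binomEval_sub (d : ℕ) (c c' : ℕ → ℝ) (N : ℕ) :
    binomEval d (fun j => c j - c' j) N = binomEval d c N - binomEval d c' N := by
  simp [binomEval, sub_mul, Finset.sum_sub_distrib]

lemma binomExpect_sub (Q d : ℕ) (c c' : ℕ → ℝ) :
    binomExpect Q d (fun j => c j - c' j) = binomExpect Q d c - binomExpect Q d c' := by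
  simp [binomExpect, sub_mul, Finset.sum_sub_distrib]

/-! ### The probability that exactly the last strip contains a zero -/

/-- Pointwise comparison of the event that only the last count is positive with its truncated
inclusion-exclusion approximation. -/
lemma abs_event_sub_le {m : ℕ} (d : ℕ) (N : Fin (m + 1) → ℕ) :
    |(∏ i : Fin m, indZero (N i.castSucc)) * (1 - indZero (N (Fin.last m)))
        - (∏ i : Fin m, altChoose d (N i.castSucc)) * (1 - altChoose d (N (Fin.last m)))|
      ≤ (∑ i : Fin m, ((N i.castSucc).choose (d + 1) : ℝ)
            * ∏ j ∈ Finset.univ.erase i, majorant d (N j.castSucc))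
        + ((N (Fin.last m)).choose (d + 1) : ℝ) * ∏ j : Fin m, majorant d (N j.castSucc) := by
  set a := ∏ i : Fin m, indZero (N i.castSucc)
  set b := ∏ i : Fin m, altChoose d (N i.castSucc) with hb
  set u := indZero (N (Fin.last m)) with hu
  set v := altChoose d (N (Fin.last m))
  -- The exact factor 1 - u lies in [0, 1], so the first term needs no majorant on the last strip.
  have e : a * (1 - u) - b * (1 - v) = (a - b) * (1 - u) + (v - u) * b := by ring
  have hu1 : |1 - u| ≤ 1 := by
    rw [hu, indZero]
    split_ifs <;> simp
  rw [e]
  refine (abs_add_le _ _).trans ?_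
  rw [abs_mul, abs_mul]
  refine add_le_add ?_ ?_
  · refine (mul_le_of_le_one_right (abs_nonneg _) hu1).trans ?_
    exact abs_prod_sub_prod_le Finset.univ _ _ (fun i : Fin m => ((N i.castSucc).choose (d + 1) : ℝ))
      (fun j : Fin m => majorant d (N j.castSucc)) (fun i => abs_indZero_le d _)
      (fun i => abs_altChoose_le d _) fun i => abs_indZero_sub_altChoose d _
  · refine mul_le_mul ?_ ?_ (abs_nonneg _) (by positivity)
    · rw [abs_sub_comm]
      exact abs_indZero_sub_altChoose d _
    · rw [hb, Finset.abs_prod]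
      exact Finset.prod_le_prod (fun i _ => abs_nonneg _) fun i _ => abs_altChoose_le d _

lemma abs_count_event_sub_le {X Ω : Type*} [Fintype X] [Nonempty X] [Fintype Ω] {d m : ℕ}
    (hd : 2 ≤ d) {Z : Fin (m + 1) → X → Ω → Prop} (hZ : StripIndep d Z) :
    |∑ ω, ((∏ i : Fin m, indZero (count fun x => Z i.castSucc x ω))
          * (1 - indZero (count fun x => Z (Fin.last m) x ω)))
        - Fintype.card Ω * (altMoment (Fintype.card X) d ^ m
          * (1 - altMoment (Fintype.card X) d))|
      ≤ Fintype.card Ω * ((m + 1) * (1 / ((d + 1)! : ℝ))) := by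
  classical
  set Q := Fintype.card X
  have hQ : 0 < Q := Fintype.card_pos
  have hmaj := binomExpect_majCoeff_mem_Icc hQ hd
  have hmaj1 : majCoeff d (d + 1) = 0 := by
    simp [majCoeff, unitCoeff, show d + 1 ≠ 2 by omega, show d ≠ 0 by omega]
  have halt1 : altCoeff d (d + 1) = 0 := by simp [altCoeff]
  have hunit1 : unitCoeff 0 (d + 1) = 0 := by simp [unitCoeff]
  have hD := binomMoment_le Q (d + 1)
  have hD0 := binomMoment_nonneg Q (d + 1)
  have hmain := sum_prod_binomEval hZ (Fin.last m)
    (Fin.snoc (α := fun _ => ℕ → ℝ) (fun _ : Fin m => altCoeff d)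
      (fun j => unitCoeff 0 j - altCoeff d j)) (by
      intro i hi
      obtain ⟨i, rfl⟩ := Fin.exists_castSucc_eq.2 hi
      simp [halt1])
  simp only [Fin.prod_univ_castSucc, Fin.snoc_castSucc, Fin.snoc_last, binomEval_sub,
    binomExpect_sub, binomEval_altCoeff, binomExpect_altCoeff,
    binomEval_unitCoeff (show 0 < d + 2 by omega), binomExpect_unitCoeff (show 0 < d + 2 by omega),
    Nat.choose_zero_right, Nat.cast_one, binomMoment_zero, Finset.prod_const, Finset.card_univ,
    Fintype.card_fin] at hmain
  have hlast := sum_prod_binomEval hZ (Fin.last m)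
    (Fin.snoc (α := fun _ => ℕ → ℝ) (fun _ : Fin m => majCoeff d) (unitCoeff (d + 1))) (by
      intro i hi
      obtain ⟨i, rfl⟩ := Fin.exists_castSucc_eq.2 hi
      simp [hmaj1])
  simp only [Fin.prod_univ_castSucc, Fin.snoc_castSucc, Fin.snoc_last, binomEval_majCoeff hd,
    binomEval_unitCoeff (show d + 1 < d + 2 by omega),
    binomExpect_unitCoeff (show d + 1 < d + 2 by omega), Finset.prod_const, Finset.card_univ,
    Fintype.card_fin] at hlast
  have hother : ∀ i : Fin m, ∑ ω, ((count fun x => Z i.castSucc x ω).choose (d + 1) : ℝ)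
        * ∏ j ∈ Finset.univ.erase i, majorant d (count fun x => Z j.castSucc x ω)
      = Fintype.card Ω * (binomMoment Q (d + 1)
        * ∏ j ∈ Finset.univ.erase i, binomExpect Q d (majCoeff d)) := by
    intro i
    -- Strip i carries the moment of order d + 1. The last strip is absent from this term, so it
    -- gets the constant function 1.
    have h := sum_prod_binomEval hZ i.castSucc
      (Fin.snoc (α := fun _ => ℕ → ℝ)
        (fun j : Fin m => if j = i then unitCoeff (d + 1) else majCoeff d) (unitCoeff 0)) (by
        intro j hj
        rcases Fin.eq_castSucc_or_eq_last j with ⟨j, rfl⟩ | rfl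
        · have : j ≠ i := fun h => hj (by rw [h])
          simp [this, hmaj1]
        · simp [hunit1])
    simp only [Fin.prod_univ_castSucc, Fin.snoc_castSucc, Fin.snoc_last,
      binomEval_unitCoeff (show 0 < d + 2 by omega),
      binomExpect_unitCoeff (show 0 < d + 2 by omega), Nat.choose_zero_right, Nat.cast_one,
      binomMoment_zero, mul_one] at h
    have split : ∀ g : Fin m → (ℕ → ℝ) → ℝ,
        ∏ j, g j (if j = i then unitCoeff (d + 1) else majCoeff d)
          = g i (unitCoeff (d + 1)) * ∏ j ∈ Finset.univ.erase i, g j (majCoeff d) := by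
      intro g
      rw [← Finset.mul_prod_erase Finset.univ _ (Finset.mem_univ i), if_pos rfl]
      congr 1
      refine Finset.prod_congr rfl fun j hj => ?_
      rw [if_neg (Finset.ne_of_mem_erase hj)]
    rw [split fun _ c => binomExpect _ d c] at h
    rw [Finset.sum_congr rfl fun ω _ =>
      split fun j c => binomEval d c (count fun x => Z j.castSucc x ω)] at h
    simpa only [binomEval_majCoeff hd, binomEval_unitCoeff (show d + 1 < d + 2 by omega),
      binomExpect_unitCoeff (show d + 1 < d + 2 by omega)] using h
  rw [← hmain, ← Finset.sum_sub_distrib]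
  refine (Finset.abs_sum_le_sum_abs _ _).trans ?_
  refine (Finset.sum_le_sum fun ω _ =>
    abs_event_sub_le d fun i => count fun x => Z i x ω).trans ?_
  rw [Finset.sum_add_distrib, Finset.sum_comm]
  simp_rw [hother]
  have hlast' : ∑ ω, ((count fun x => Z (Fin.last m) x ω).choose (d + 1) : ℝ)
        * ∏ j : Fin m, majorant d (count fun x => Z j.castSucc x ω)
      = Fintype.card Ω * (binomMoment Q (d + 1) * binomExpect Q d (majCoeff d) ^ m) := by
    rw [mul_comm (binomMoment Q (d + 1)), ← hlast]
    exact Finset.sum_congr rfl fun ω _ => mul_comm _ _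
  rw [hlast', ← Finset.mul_sum, ← mul_add]
  refine mul_le_mul_of_nonneg_left ?_ (Nat.cast_nonneg _)
  have hb : ∀ k : ℕ, binomMoment Q (d + 1) * binomExpect Q d (majCoeff d) ^ k
      ≤ 1 / ((d + 1)! : ℝ) := fun k =>
    (mul_le_of_le_one_right hD0 (pow_le_one₀ hmaj.1 hmaj.2)).trans hD
  have hsum : ∑ i : Fin m, binomMoment Q (d + 1)
      * ∏ j ∈ Finset.univ.erase i, binomExpect Q d (majCoeff d) ≤ m * (1 / ((d + 1)! : ℝ)) := by
    refine (Finset.sum_le_sum (g := fun _ => 1 / ((d + 1)! : ℝ)) fun i _ => ?_).trans (by simp)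
    rw [Finset.prod_const]
    exact hb _
  linarith [hb m]

/-! ### Interpolation on vertical strips -/

section

variable {K : Type*} [Field K]

/-- Lagrange interpolation at finitely many points of affine space. -/
lemma exists_interpolation {σ : Type*} (T : Finset (σ → K)) (e : ℕ)
    (hT : T.card ≤ e + 1) (b : (σ → K) → K) :
    ∃ G : MvPolynomial σ K, G.totalDegree ≤ e ∧ ∀ x ∈ T, MvPolynomial.eval x G = b x := by
  classical
  have hsep : ∀ x y : σ → K, ∃ P : MvPolynomial σ K, P.totalDegree ≤ 1 ∧
      (x ≠ y → MvPolynomial.eval x P = 1 ∧ MvPolynomial.eval y P = 0) := by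
    intro x y
    by_cases h : x = y
    · exact ⟨0, by simp, fun h' => (h' h).elim⟩
    · obtain ⟨i, hi⟩ := Function.ne_iff.1 h
      have hi' : x i - y i ≠ 0 := sub_ne_zero.2 hi
      refine ⟨MvPolynomial.C (x i - y i)⁻¹ * (MvPolynomial.X i - MvPolynomial.C (y i)), ?_,
        fun _ => ⟨by simp [hi'], by simp⟩⟩
      refine (MvPolynomial.totalDegree_mul _ _).trans ?_
      rw [MvPolynomial.totalDegree_C, zero_add]
      refine (MvPolynomial.totalDegree_sub _ _).trans ?_
      rw [MvPolynomial.totalDegree_C, MvPolynomial.totalDegree_X]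
      simp
  choose P hP1 hP using hsep
  refine ⟨∑ x ∈ T, MvPolynomial.C (b x) * ∏ y ∈ T.erase x, P x y, ?_, fun x hx => ?_⟩
  · refine MvPolynomial.totalDegree_finsetSum_le fun x hx => ?_
    refine (MvPolynomial.totalDegree_mul _ _).trans ?_
    rw [MvPolynomial.totalDegree_C, zero_add]
    refine (MvPolynomial.totalDegree_finsetProd _ _).trans ?_
    refine (Finset.sum_le_sum fun y _ => hP1 x y).trans ?_
    rw [Finset.sum_const, Finset.card_erase_of_mem hx, smul_eq_mul, mul_one]
    omega
  · rw [map_sum, Finset.sum_eq_single_of_mem x hx]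
    · rw [map_mul, MvPolynomial.eval_C, map_prod, Finset.prod_eq_one, mul_one]
      exact fun y hy => (hP x y (Finset.ne_of_mem_erase hy).symm).1
    · intro z hz hzx
      rw [map_mul, map_prod, Finset.prod_eq_zero (Finset.mem_erase.2 ⟨hzx.symm, hx⟩)
        (hP z x hzx).2, mul_zero]

/-- The point of `K^r` with first `r - s` coordinates `a` and last `s` coordinates `x`. -/
def stripPoint {r s : ℕ} (a : Fin (r - s) → K) (x : Fin s → K) (i : Fin r) : K :=
  if hi : i.val < r - s then a ⟨i.val, hi⟩ else x ⟨i.val - (r - s), by omega⟩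

lemma eval_specialize {r s : ℕ} (a : Fin (r - s) → K) (x : Fin s → K)
    (F : MvPolynomial (Fin r) K) :
    MvPolynomial.eval x (specialize a F) = MvPolynomial.eval (stripPoint a x) F := by
  have h : (MvPolynomial.aeval x).comp (MvPolynomial.aeval
      (fun i : Fin r =>
        if hi : i.val < r - s then (MvPolynomial.C (a ⟨i.val, hi⟩) : MvPolynomial (Fin s) K)
        else MvPolynomial.X ⟨i.val - (r - s), by omega⟩))
      = (MvPolynomial.aeval (stripPoint a x) : MvPolynomial (Fin r) K →ₐ[K] K) := by
    ext i
    simp only [AlgHom.comp_apply, MvPolynomial.aeval_X, stripPoint]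
    split_ifs with hi
    · simp
    · simp
  have := DFunLike.congr_fun h F
  simpa [specialize, MvPolynomial.aeval_eq_eval] using this

/-- The strips `a` are in general position: affine functions take arbitrary values on them. -/
def GeneralPosition {ι : Type*} {n : ℕ} (a : ι → Fin n → K) : Prop :=
  ∀ b : ι → K, ∃ (c₀ : K) (c : Fin n → K), ∀ i, c₀ + ∑ k, c k * a i k = b i

lemma exists_base_polynomial {r s : ℕ} (hsr : s < r) (G : MvPolynomial (Fin s) K) :
    ∃ H : MvPolynomial (Fin r) K, H.totalDegree ≤ G.totalDegree ∧
      ∀ (a : Fin (r - s) → K) (x : Fin s → K),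
        MvPolynomial.eval (stripPoint a x) H = MvPolynomial.eval x G := by
  refine ⟨MvPolynomial.rename (fun i : Fin s => (⟨i.val + (r - s), by omega⟩ : Fin r)) G,
    MvPolynomial.totalDegree_rename_le _ _, fun a x => ?_⟩
  rw [MvPolynomial.eval_rename]
  congr 2
  funext i
  simp [stripPoint]

/-- An affine form in the first r - s coordinates that selects strip i. -/
lemma exists_strip_polynomial {r s : ℕ} {ι : Type*} [DecidableEq ι]
    {a : ι → Fin (r - s) → K} (ha : GeneralPosition a) (i : ι) :
    ∃ H : MvPolynomial (Fin r) K, H.totalDegree ≤ 1 ∧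
      ∀ (j : ι) (x : Fin s → K),
        MvPolynomial.eval (stripPoint (a j) x) H = if j = i then 1 else 0 := by
  obtain ⟨c₀, c, hc⟩ := ha fun j => if j = i then 1 else 0
  refine ⟨MvPolynomial.C c₀ + ∑ k : Fin (r - s), MvPolynomial.C (c k)
    * MvPolynomial.X (⟨k.val, by omega⟩ : Fin r), ?_, fun j x => ?_⟩
  · refine (MvPolynomial.totalDegree_add _ _).trans (max_le (by simp) ?_)
    refine MvPolynomial.totalDegree_finsetSum_le fun k _ => ?_
    refine (MvPolynomial.totalDegree_mul _ _).trans ?_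
    rw [MvPolynomial.totalDegree_C, MvPolynomial.totalDegree_X]
  · rw [← hc j]
    simp [stripPoint]

/-- Interpolation by a polynomial of degree at most `d` at `d + 1` points of one strip and `d`
points of each of the other strips. -/
lemma exists_strip_interpolation {r s d : ℕ} (hsr : s < r) (hd : 1 ≤ d) {ι : Type*} [Fintype ι]
    {a : ι → Fin (r - s) → K} (ha : GeneralPosition a) (i₀ : ι) (T : ι → Finset (Fin s → K))
    (h₀ : (T i₀).card ≤ d + 1) (hT : ∀ i, i ≠ i₀ → (T i).card ≤ d) (b : ι → (Fin s → K) → K) :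
    ∃ F : MvPolynomial (Fin r) K, F.totalDegree ≤ d ∧
      ∀ i, ∀ x ∈ T i, MvPolynomial.eval (stripPoint (a i) x) F = b i x := by
  classical
  -- The exceptional strip uses the full degree d. The other strips are corrected by selector times
  -- polynomial; the selector spends one degree, leaving d - 1 and hence d points.
  obtain ⟨G₀, hG₀d, hG₀⟩ := exists_interpolation (T i₀) d h₀ (b i₀)
  have hG : ∀ i, ∃ G : MvPolynomial (Fin s) K, G.totalDegree ≤ d - 1 ∧ (i ≠ i₀ →
      ∀ x ∈ T i, MvPolynomial.eval x G = b i x - MvPolynomial.eval x G₀) := by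
    intro i
    by_cases hi : i = i₀
    · exact ⟨0, by simp, fun h => (h hi).elim⟩
    · obtain ⟨G, h1, h2⟩ := exists_interpolation (T i) (d - 1) (by have := hT i hi; omega)
        fun x => b i x - MvPolynomial.eval x G₀
      exact ⟨G, h1, fun _ => h2⟩
  choose G hGd hG using hG
  obtain ⟨H₀, hH₀d, hH₀⟩ := exists_base_polynomial hsr G₀
  choose H hHd hH using fun i => exists_base_polynomial hsr (G i)
  choose l hld hl using exists_strip_polynomial ha
  refine ⟨H₀ + ∑ i ∈ Finset.univ.erase i₀, l i * H i, ?_, fun i x hx => ?_⟩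
  · refine (MvPolynomial.totalDegree_add _ _).trans (max_le (hH₀d.trans hG₀d) ?_)
    refine MvPolynomial.totalDegree_finsetSum_le fun i _ => ?_
    refine (MvPolynomial.totalDegree_mul _ _).trans ?_
    have := hld i
    have := hHd i
    have := hGd i
    omega
  · rw [map_add, hH₀, map_sum]
    simp_rw [map_mul, hH, hl, ite_mul, one_mul, zero_mul]
    rw [Finset.sum_ite_eq]
    by_cases hi : i = i₀
    · subst hi
      simp [hG₀ x hx]
    · rw [if_pos (by simp [hi]), hG i hi x hx]
      ring

/-- The evaluation map at the chosen points is onto, so its kernel has index q to the number of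
points. The s equations vary independently, which raises this index to the power s. -/
lemma stripIndep_of_generalPosition [Fintype K] {r s d : ℕ} (hsr : s < r) (hd : 1 ≤ d)
    {ι : Type*} [Fintype ι] [Fintype (Fin s → PolyDeg K r d)]
    {a : ι → Fin (r - s) → K} (ha : GeneralPosition a) :
    StripIndep d fun (i : ι) (x : Fin s → K) (F : Fin s → PolyDeg K r d) =>
      ∀ k, MvPolynomial.eval (stripPoint (a i) x) (F k : MvPolynomial (Fin r) K) = 0 := by
  classical
  intro i₀ T h₀ hT
  let L : PolyDeg K r d →ₗ[K] ((Σ i, T i) → K) :=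
    LinearMap.pi fun p => (MvPolynomial.aeval (stripPoint (a p.1) p.2.1)).toLinearMap ∘ₗ
      (MvPolynomial.restrictTotalDegree (Fin r) K d).subtype
  have hL : ∀ (F : PolyDeg K r d) p,
      L F p = MvPolynomial.eval (stripPoint (a p.1) p.2.1) (F : MvPolynomial (Fin r) K) :=
    fun F p => by simp [L, MvPolynomial.aeval_eq_eval]
  have hsurj : Function.Surjective L := by
    intro b
    obtain ⟨F, hFd, hF⟩ := exists_strip_interpolation hsr hd ha i₀ T h₀ hT
      fun i x => if hx : x ∈ T i then b ⟨i, x, hx⟩ else 0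
    refine ⟨⟨F, (MvPolynomial.mem_restrictTotalDegree _ _ _).2 hFd⟩, ?_⟩
    funext ⟨i, x, hx⟩
    rw [hL]
    simpa [hx] using hF i x hx
  have hker : Nat.card (LinearMap.ker L) * Fintype.card K ^ (∑ i, (T i).card)
      = Nat.card (PolyDeg K r d) := by
    rw [Submodule.card_eq_card_quotient_mul_card (LinearMap.ker L),
      Nat.card_congr (L.quotKerEquivOfSurjective hsurj).toEquiv, Nat.card_fun,
      Nat.card_eq_fintype_card (α := K), Nat.card_eq_fintype_card (α := Σ i, T i),
      Fintype.card_sigma]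
    simp only [Fintype.card_coe]
  have hcount : count (fun F : Fin s → PolyDeg K r d => ∀ i, ∀ x ∈ T i, ∀ k,
      MvPolynomial.eval (stripPoint (a i) x) (F k : MvPolynomial (Fin r) K) = 0)
      = Nat.card (LinearMap.ker L) ^ s := by
    rw [count, ← Fintype.card_subtype, ← Nat.card_eq_fintype_card]
    have : Nat.card (Fin s → LinearMap.ker L) = Nat.card (LinearMap.ker L) ^ s := by
      rw [Nat.card_fun]
      simp
    rw [← this]
    refine Nat.card_congr
      ((Equiv.subtypeEquivRight fun F => ?_).trans
        (Equiv.subtypePiEquivPi (p := fun (_ : Fin s) (F : PolyDeg K r d) => F ∈ LinearMap.ker L)))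
    simp only [LinearMap.mem_ker]
    constructor
    · intro h k
      funext p
      rw [hL]
      exact h p.1 p.2.1 p.2.2 k
    · intro h i x hx k
      rw [← hL (F k) ⟨i, x, hx⟩, h k]
      rfl
  rw [hcount, Fintype.card_fun, Fintype.card_fin, ← Nat.card_eq_fintype_card (α := Fin s → _),
    Nat.card_fun, ← hker]
  simp only [Nat.card_eq_fintype_card, Fintype.card_fin]
  rw [mul_pow, ← pow_mul, ← pow_mul, mul_comm s]

/-! ### Almost all tuples of strips are in general position -/

lemma generalPosition_of_linearIndependent {m n : ℕ} {a : Fin (m + 1) → Fin n → K}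
    (h : LinearIndependent K fun i : Fin m => a i.succ - a 0) : GeneralPosition a := by
  intro b
  obtain ⟨f, hf⟩ : ∃ f : (Fin n → K) →ₗ[K] K, ∀ i : Fin m, f (a i.succ - a 0) = b i.succ - b 0 := by
    obtain ⟨g, hg⟩ := LinearMap.exists_leftInverse_of_injective _ (LinearMap.ker_eq_bot.2 h)
    refine ⟨Finsupp.linearCombination K (fun i : Fin m => b i.succ - b 0) ∘ₗ g, fun i => ?_⟩
    have := LinearMap.congr_fun hg (Finsupp.single i 1)
    simp only [LinearMap.comp_apply, Finsupp.linearCombination_single, one_smul,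
      LinearMap.id_apply] at this
    rw [LinearMap.comp_apply, this, Finsupp.linearCombination_single, one_smul]
  have hexp : ∀ v : Fin n → K, ∑ k, f (Pi.single k 1) * v k = f v := by
    intro v
    conv_rhs => rw [pi_eq_sum_univ' v]
    rw [map_sum]
    refine Finset.sum_congr rfl fun k _ => ?_
    rw [map_smul, smul_eq_mul, mul_comm]
  refine ⟨b 0 - f (a 0), fun k => f (Pi.single k 1), fun i => ?_⟩
  rw [hexp]
  refine Fin.cases ?_ (fun i => ?_) i
  · ring
  · have := hf i
    rw [map_sub] at this
    linear_combination this

end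

section

variable {K : Type*} [Field K] [Fintype K]

lemma one_sub_sum_le_prod_one_sub (m : ℕ) (x : ℕ → ℝ) (hx0 : ∀ i, 0 ≤ x i)
    (hx1 : ∀ i < m, x i ≤ 1) :
    1 - ∑ i ∈ Finset.range m, x i ≤ ∏ i ∈ Finset.range m, (1 - x i) := by
  induction m with
  | zero => simp
  | succ m ih =>
    rw [Finset.sum_range_succ, Finset.prod_range_succ]
    have h := ih fun i hi => hx1 i (by omega)
    have hp : ∏ i ∈ Finset.range m, (1 - x i) ≤ 1 :=
      Finset.prod_le_one
        (fun i hi => sub_nonneg.2 (hx1 i (by have := Finset.mem_range.1 hi; omega)))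
        fun i _ => sub_le_self _ (hx0 i)
    nlinarith [hx0 m]

open Classical in
/-- Embeddings whose differences from the first point are linearly independent. -/
def goodTuples (K : Type*) [Field K] [Fintype K] (n m : ℕ) : Finset (Fin (m + 1) ↪ (Fin n → K)) :=
  Finset.univ.filter fun a => LinearIndependent K fun i : Fin m => a i.succ - a 0

/-- Choose the first point freely and add any independent m-tuple to it. The m + 1 points are
distinct because independent vectors are nonzero and distinct. -/
lemma le_card_goodTuples {n m : ℕ} (hmn : m ≤ n) :
    Fintype.card K ^ n * ∏ i : Fin m, (Fintype.card K ^ n - Fintype.card K ^ i.val)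
      ≤ (goodTuples K n m).card := by
  classical
  have h := card_linearIndependent (K := K) (V := Fin n → K) (k := m) (by simpa using hmn)
  rw [Module.finrank_fin_fun] at h
  rw [← h, goodTuples, ← Fintype.card_subtype, Nat.card_eq_fintype_card]
  have hV : Fintype.card (Fin n → K) = Fintype.card K ^ n := by simp
  rw [← hV, ← Fintype.card_prod]
  have hinj : ∀ (v : Fin n → K) (s : Fin m → Fin n → K), LinearIndependent K s →
      Function.Injective (Fin.cons v fun i => v + s i : Fin (m + 1) → Fin n → K) := by
    intro v s hs
    rw [Fin.cons_injective_iff]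
    refine ⟨?_, fun i j hij => hs.injective (add_left_cancel hij)⟩
    rintro ⟨i, hi⟩
    exact hs.ne_zero i (by simpa using hi)
  refine Fintype.card_le_of_injective
    (fun p : (Fin n → K) × {s : Fin m → Fin n → K // LinearIndependent K s} =>
      (⟨⟨_, hinj p.1 p.2.1 p.2.2⟩, by simpa using p.2.2⟩ :
        {a : Fin (m + 1) ↪ (Fin n → K) // LinearIndependent K fun i : Fin m => a i.succ - a 0}))
    fun p p' hpp => ?_
  have hfun := congrArg (fun a => (a.1 : Fin (m + 1) → Fin n → K)) hpp
  simp only [Function.Embedding.coeFn_mk] at hfun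
  obtain ⟨h1, h2⟩ := Fin.cons_inj.1 hfun
  refine Prod.ext h1 (Subtype.ext (funext fun i => ?_))
  have := congrFun h2 i
  rw [h1] at this
  exact add_left_cancel this

lemma card_mul_le_card_goodTuples {n m : ℕ} (hmn : m ≤ n) :
    (1 - 2 / (Fintype.card K : ℝ)) * Fintype.card (Fin (m + 1) ↪ (Fin n → K))
      ≤ (goodTuples K n m).card := by
  classical
  set q := Fintype.card K with hq
  have hq2 : 2 ≤ q := Fintype.one_lt_card
  have hq2' : (2 : ℝ) ≤ q := by exact_mod_cast hq2
  have hq0 : (0 : ℝ) < q := by linarith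
  have hqn : (0 : ℝ) < (q : ℝ) ^ n := by positivity
  have hT : (Fintype.card (Fin (m + 1) ↪ (Fin n → K)) : ℝ) ≤ ((q : ℝ) ^ n) ^ (m + 1) := by
    have h : Fintype.card (Fin (m + 1) ↪ (Fin n → K))
        ≤ Fintype.card (Fin (m + 1) → Fin n → K) :=
      Fintype.card_le_of_injective _ DFunLike.coe_injective
    simp only [Fintype.card_fun, Fintype.card_fin] at h
    exact_mod_cast h
  have hG : (q : ℝ) ^ n * ∏ i ∈ Finset.range m, ((q : ℝ) ^ n - (q : ℝ) ^ i)
      ≤ (goodTuples K n m).card := by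
    have h := le_card_goodTuples (K := K) hmn
    rw [Fin.prod_univ_eq_prod_range (fun i => Fintype.card K ^ n - Fintype.card K ^ i)] at h
    have h2 : ((Fintype.card K ^ n * ∏ i ∈ Finset.range m,
        (Fintype.card K ^ n - Fintype.card K ^ i) : ℕ) : ℝ) ≤ (goodTuples K n m).card := by
      exact_mod_cast h
    refine le_trans (le_of_eq ?_) h2
    rw [Nat.cast_mul, Nat.cast_prod, Nat.cast_pow]
    congr 1
    refine Finset.prod_congr rfl fun i hi => ?_
    rw [Nat.cast_sub (Nat.pow_le_pow_right (by omega)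
      (by have := Finset.mem_range.1 hi; omega))]
    push_cast
    rfl
  have hprod : (q : ℝ) ^ n * ∏ i ∈ Finset.range m, ((q : ℝ) ^ n - (q : ℝ) ^ i)
      = ((q : ℝ) ^ n) ^ (m + 1) * ∏ i ∈ Finset.range m, (1 - (q : ℝ) ^ i / (q : ℝ) ^ n) := by
    have : ∀ i, (q : ℝ) ^ n - (q : ℝ) ^ i = (q : ℝ) ^ n * (1 - (q : ℝ) ^ i / (q : ℝ) ^ n) :=
      fun i => by field_simp
    simp_rw [this]
    rw [Finset.prod_mul_distrib, Finset.prod_const, Finset.card_range]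
    ring
  have hunion := one_sub_sum_le_prod_one_sub m (fun i => (q : ℝ) ^ i / (q : ℝ) ^ n)
    (fun i => by positivity) fun i hi => by
      rw [div_le_one hqn]
      exact pow_le_pow_right₀ (by linarith) (by omega)
  -- The geometric sum times q - 1 is at most q^n, and q ≤ 2(q - 1).
  have hsum : ∑ i ∈ Finset.range m, (q : ℝ) ^ i / (q : ℝ) ^ n ≤ 2 / q := by
    rw [← Finset.sum_div, div_le_div_iff₀ hqn hq0]
    have hg : (∑ i ∈ Finset.range m, (q : ℝ) ^ i) * (q - 1) = (q : ℝ) ^ m - 1 := geom_sum_mul _ m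
    have hs0 : 0 ≤ ∑ i ∈ Finset.range m, (q : ℝ) ^ i :=
      Finset.sum_nonneg fun i _ => by positivity
    have hm : (q : ℝ) ^ m ≤ (q : ℝ) ^ n := pow_le_pow_right₀ (by linarith) hmn
    nlinarith
  have h2q : 0 ≤ 1 - 2 / (q : ℝ) := by
    rw [sub_nonneg, div_le_one hq0]
    exact hq2'
  calc (1 - 2 / (q : ℝ)) * Fintype.card (Fin (m + 1) ↪ (Fin n → K))
      ≤ (1 - 2 / (q : ℝ)) * ((q : ℝ) ^ n) ^ (m + 1) := mul_le_mul_of_nonneg_left hT h2q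
    _ ≤ (∏ i ∈ Finset.range m, (1 - (q : ℝ) ^ i / (q : ℝ) ^ n)) * ((q : ℝ) ^ n) ^ (m + 1) := by
        refine mul_le_mul_of_nonneg_right ?_ (by positivity)
        linarith
    _ ≤ (goodTuples K n m).card := by
        rw [mul_comm, ← hprod]
        exact hG

/-! ### The search on vertical strips -/

lemma searchCount_eq_iff {K : Type*} [Field K] {r s d m : ℕ} (ω : Sample K r s d (m + 1)) :
    searchCount ω = ((m + 1 : ℕ) : ℕ∞) ↔
      (∀ i : Fin m, numZeros (fun k => specialize (ω.1 i.castSucc)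
        (ω.2 k : MvPolynomial (Fin r) K)) = 0) ∧
      0 < numZeros (fun k => specialize (ω.1 (Fin.last m))
        (ω.2 k : MvPolynomial (Fin r) K)) := by
  set N : Fin (m + 1) → ℕ := fun j =>
    numZeros (fun k => specialize (ω.1 j) (ω.2 k : MvPolynomial (Fin r) K)) with hN
  change sInf {n : ℕ∞ | ∃ j : Fin (m + 1), n = ((j.val + 1 : ℕ) : ℕ∞) ∧ 0 < N j} = _ ↔
    (∀ i : Fin m, N i.castSucc = 0) ∧ 0 < N (Fin.last m)
  constructor
  · intro h
    have hne : {n : ℕ∞ | ∃ j : Fin (m + 1), n = ((j.val + 1 : ℕ) : ℕ∞) ∧ 0 < N j}.Nonempty := by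
      by_contra hne
      rw [Set.not_nonempty_iff_eq_empty] at hne
      rw [hne, sInf_empty] at h
      exact ENat.top_ne_natCast _ h
    have hmem := csInf_mem hne
    rw [h] at hmem
    obtain ⟨j, hj, hj0⟩ := hmem
    have hjm : m + 1 = j.val + 1 := by exact_mod_cast hj
    have hjl : j = Fin.last m := Fin.ext (by simp; omega)
    refine ⟨fun i => ?_, hjl ▸ hj0⟩
    by_contra hi
    have hle : ((m + 1 : ℕ) : ℕ∞) ≤ ((i.val + 1 : ℕ) : ℕ∞) :=
      h ▸ sInf_le ⟨i.castSucc, rfl, Nat.pos_of_ne_zero hi⟩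
    have : m + 1 ≤ i.val + 1 := by exact_mod_cast hle
    omega
  · rintro ⟨h0, hpos⟩
    refine le_antisymm (sInf_le ⟨Fin.last m, rfl, hpos⟩) (le_sInf ?_)
    rintro n ⟨j, rfl, hj⟩
    rcases Fin.eq_castSucc_or_eq_last j with ⟨i, rfl⟩ | rfl
    · rw [h0 i] at hj
      exact absurd hj (lt_irrefl 0)
    · simp

open Classical in
lemma event_indicator {m : ℕ} (N : Fin (m + 1) → ℕ) :
    (∏ i : Fin m, indZero (N i.castSucc)) * (1 - indZero (N (Fin.last m)))
      = if (∀ i : Fin m, N i.castSucc = 0) ∧ 0 < N (Fin.last m) then 1 else 0 := by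
  simp only [indZero]
  rw [Finset.prod_ite_zero]
  by_cases h : ∀ i : Fin m, N i.castSucc = 0
  · by_cases h' : N (Fin.last m) = 0
    · simp [h, h']
    · simp [h, h', Nat.pos_of_ne_zero h']
  · simp [h]

lemma numZeros_specialize_eq {r s : ℕ} (a : Fin (r - s) → K)
    (F : Fin s → MvPolynomial (Fin r) K) :
    numZeros (fun k => specialize a (F k))
      = count fun x : Fin s → K => ∀ k, MvPolynomial.eval (stripPoint a x) (F k) = 0 := by
  classical
  rw [numZeros, count, ← Fintype.card_subtype, Nat.card_eq_fintype_card]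
  simp_rw [eval_specialize]

/-- For strips in general position, the conditional probability is close to the main term. -/
lemma abs_ncard_div_sub_le {r s d m D : ℕ} (hsr : s < r) (hd : 2 ≤ d) (hm : 1 ≤ m)
    (hD : |mu d - mu D| ≤ 1 / ((d + 1)! : ℝ)) {a : Fin (m + 1) ↪ (Fin (r - s) → K)}
    (ha : GeneralPosition a) :
    |({F : Fin s → PolyDeg K r d | searchCount (a, F) = ((m + 1 : ℕ) : ℕ∞)}.ncard : ℝ)
          / (Nat.card (Fin s → PolyDeg K r d) : ℝ) - mu D * (1 - mu D) ^ m|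
      ≤ 1 / ((d + 1)! : ℝ) * (Real.exp 1 ^ m + 1 / 2)
        + 5 / (Fintype.card K : ℝ) ^ s * (2 - mu d) ^ m := by
  classical
  have := Fintype.ofFinite (Fin s → PolyDeg K r d)
  set M := Fintype.card (Fin s → PolyDeg K r d) with hM
  have hM0 : (0 : ℝ) < M := by exact_mod_cast Fintype.card_pos
  have hZ := stripIndep_of_generalPosition hsr (by omega : 1 ≤ d) ha
  have h := abs_count_event_sub_le hd hZ
  simp_rw [← numZeros_specialize_eq] at h
  rw [Finset.sum_congr rfl fun F _ => event_indicator (fun i => numZeros (fun k =>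
    specialize (a i) (F k : MvPolynomial (Fin r) K)))] at h
  have hcard : Fintype.card (Fin s → K) = Fintype.card K ^ s := by simp
  have hQ : 0 < Fintype.card K ^ s := pow_pos Fintype.card_pos s
  rw [hcard, Finset.sum_boole] at h
  have hset : ({F : Fin s → PolyDeg K r d | searchCount (a, F) = ((m + 1 : ℕ) : ℕ∞)}.ncard : ℝ)
      = (Finset.univ.filter fun F : Fin s → PolyDeg K r d =>
          (∀ i : Fin m, numZeros (fun k => specialize (a i.castSucc)
            (F k : MvPolynomial (Fin r) K)) = 0) ∧
          0 < numZeros (fun k => specialize (a (Fin.last m))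
            (F k : MvPolynomial (Fin r) K))).card := by
    rw [← Set.ncard_coe_finset]
    congr 2
    ext F
    simpa using searchCount_eq_iff (a, F)
  rw [← hset, ← hM] at h
  set E := ({F : Fin s → PolyDeg K r d | searchCount (a, F) = ((m + 1 : ℕ) : ℕ∞)}.ncard : ℝ)
  set p := altMoment (Fintype.card K ^ s) d with hp
  have h1 : |E / M - p ^ m * (1 - p)| ≤ (m + 1) * (1 / ((d + 1)! : ℝ)) := by
    have e : E / M - p ^ m * (1 - p) = (E - M * (p ^ m * (1 - p))) / M := by field_simp
    rw [e, abs_div, abs_of_pos hM0, div_le_iff₀ hM0, mul_comm _ (M : ℝ)]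
    exact h
  have hp01 := altMoment_mem_Icc hQ d
  have hmu := one_sub_mu_mem_Icc D
  have hmud := one_sub_mu_mem_Icc d
  have h2 : |p ^ m * (1 - p) - mu D * (1 - mu D) ^ m| ≤ 5 / (Fintype.card K : ℝ) ^ s
      + 1 / ((d + 1)! : ℝ) := by
    have h3 := abs_pow_mul_one_sub_sub_le m hp01.1 hp01.2 hmu.1 hmu.2
    have h4 := abs_altMoment_sub_le hQ d
    rw [← hp] at h3 h4
    push_cast at h4
    have e : (1 - mu D) ^ m * (1 - (1 - mu D)) = mu D * (1 - mu D) ^ m := by ring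
    rw [e] at h3
    refine h3.trans ?_
    have e2 : p - (1 - mu D) = (p - (1 - mu d)) + -(mu d - mu D) := by ring
    rw [e2]
    refine (abs_add_le _ _).trans ?_
    rw [abs_neg]
    exact add_le_add h4 hD
  have h5 : 5 / (Fintype.card K : ℝ) ^ s ≤ 5 / (Fintype.card K : ℝ) ^ s * (2 - mu d) ^ m :=
    le_mul_of_one_le_right (by positivity) (one_le_pow₀ (by linarith))
  have h6 : 1 / ((d + 1)! : ℝ) * ((m : ℝ) + 2) ≤ 1 / ((d + 1)! : ℝ) * (Real.exp 1 ^ m + 1 / 2) :=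
    mul_le_mul_of_nonneg_left (by linarith [add_three_halves_le_exp_pow hm]) (by positivity)
  rw [Nat.card_eq_fintype_card, ← hM]
  have h7 := abs_sub_le (E / M) (p ^ m * (1 - p)) (mu D * (1 - mu D) ^ m)
  linarith

/-- Averages the conditional estimate over the tuples of strips. Leaving `D` free, up to a change of
1/(d+1)! in μ, serves both `D = d` and `D = d + 1`. -/
lemma abs_uniformProb_sub_le {r s d m D : ℕ} (hsr : s < r) (hd : 2 ≤ d) (hm : 1 ≤ m)
    (hmr : m ≤ r - s) (hD : |mu d - mu D| ≤ 1 / ((d + 1)! : ℝ)) :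
    |uniformProb {ω : Sample K r s d (m + 1) | searchCount ω = ((m + 1 : ℕ) : ℕ∞)}
          - mu D * (1 - mu D) ^ m|
      ≤ 1 / ((d + 1)! : ℝ) * (Real.exp 1 ^ m + 1 / 2) + 2 / (Fintype.card K : ℝ)
        + 5 / (Fintype.card K : ℝ) ^ s * (2 - mu d) ^ m := by
  classical
  have := Fintype.ofFinite (Fin s → PolyDeg K r d)
  set v := mu D * (1 - mu D) ^ m
  set ε := 1 / ((d + 1)! : ℝ) * (Real.exp 1 ^ m + 1 / 2)
    + 5 / (Fintype.card K : ℝ) ^ s * (2 - mu d) ^ m with hε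
  have hmud := one_sub_mu_mem_Icc d
  have hmu := one_sub_mu_mem_Icc D
  have hε0 : 0 ≤ ε := by
    have : (0 : ℝ) ≤ 2 - mu d := by linarith
    positivity
  set A := Fin (m + 1) ↪ (Fin (r - s) → K)
  set M : ℝ := (Nat.card (Fin s → PolyDeg K r d) : ℝ) with hM
  have hM0 : 0 < M := by
    rw [hM]
    exact_mod_cast Nat.card_pos
  let p : A → ℝ := fun a =>
    ({F : Fin s → PolyDeg K r d | searchCount (a, F) = ((m + 1 : ℕ) : ℕ∞)}.ncard : ℝ) / M
  have hG := card_mul_le_card_goodTuples (K := K) hmr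
  have hA0 : (0 : ℝ) < Fintype.card A := by
    have hpos := le_card_goodTuples (K := K) hmr
    have hq : 2 ≤ Fintype.card K := Fintype.one_lt_card
    have h1 : 0 < Fintype.card K ^ (r - s)
        * ∏ i : Fin m, (Fintype.card K ^ (r - s) - Fintype.card K ^ i.val) := by
      refine Nat.mul_pos (by positivity) (Finset.prod_pos fun i _ => Nat.sub_pos_of_lt ?_)
      exact Nat.pow_lt_pow_right (by omega) (by omega)
    have h2 : (goodTuples K (r - s) m).card ≤ Fintype.card A := Finset.card_le_univ _
    exact_mod_cast h1.trans_le (hpos.trans h2)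
  have hprob : uniformProb {ω : Sample K r s d (m + 1) | searchCount ω = ((m + 1 : ℕ) : ℕ∞)}
      = (∑ a, p a) / Fintype.card A := by
    have hcard : {ω : Sample K r s d (m + 1) | searchCount ω = ((m + 1 : ℕ) : ℕ∞)}.ncard
        = ∑ a : A, {F : Fin s → PolyDeg K r d |
            searchCount (a, F) = ((m + 1 : ℕ) : ℕ∞)}.ncard := by
      simp_rw [← Nat.card_coe_set_eq]
      rw [← Nat.card_sigma]
      exact Nat.card_congr
        { toFun := fun ω => ⟨ω.1.1, ω.1.2, ω.2⟩
          invFun := fun x => ⟨(x.1, x.2.1), x.2.2⟩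
          left_inv := fun _ => rfl
          right_inv := fun _ => rfl }
    rw [uniformProb, hcard, Nat.card_prod, Nat.card_eq_fintype_card (α := A), ← Finset.sum_div]
    push_cast
    rw [div_div, mul_comm (M : ℝ)]
  have hv : 0 ≤ v ∧ v ≤ 1 := by
    have h0 : 0 ≤ mu D := by linarith
    have h1 : (1 - mu D) ^ m ≤ 1 := pow_le_one₀ hmu.1 hmu.2
    have h2 : 0 ≤ (1 - mu D) ^ m := pow_nonneg hmu.1 m
    exact ⟨mul_nonneg h0 h2, mul_le_one₀ (by linarith) h2 h1⟩
  have hbad : ∀ a, |p a - v| ≤ 1 := by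
    intro a
    have h0 : 0 ≤ p a := by positivity
    have h1 : p a ≤ 1 := by
      rw [div_le_one hM0, hM]
      exact_mod_cast Set.ncard_le_card _
    rw [abs_le]
    constructor <;> linarith [hv.1, hv.2]
  have hgood : ∀ a ∈ goodTuples K (r - s) m, |p a - v| ≤ ε := fun a ha =>
    abs_ncard_div_sub_le hsr hd hm hD
      (generalPosition_of_linearIndependent (Finset.mem_filter.1 ha).2)
  have hbound : ∀ a, |p a - v| ≤ ε + if a ∈ goodTuples K (r - s) m then 0 else 1 := by
    intro a
    split_ifs with ha
    · rw [add_zero]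
      exact hgood a ha
    · linarith [hbad a]
  have hsum : ∑ a : A, (ε + if a ∈ goodTuples K (r - s) m then (0 : ℝ) else 1)
      = Fintype.card A * ε + (Fintype.card A - (goodTuples K (r - s) m).card) := by
    have : ∀ a : A, (if a ∈ goodTuples K (r - s) m then (0 : ℝ) else 1)
        = 1 - if a ∈ goodTuples K (r - s) m then (1 : ℝ) else 0 := fun a => by split_ifs <;> simp
    simp_rw [this]
    rw [Finset.sum_add_distrib, Finset.sum_sub_distrib, Finset.sum_boole]
    simp
  have e : (∑ a, p a) / Fintype.card A - v = (∑ a, (p a - v)) / Fintype.card A := by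
    rw [Finset.sum_sub_distrib, Finset.sum_const, Finset.card_univ, nsmul_eq_mul]
    field_simp
  rw [hprob, e, abs_div, abs_of_pos hA0, div_le_iff₀ hA0]
  refine (Finset.abs_sum_le_sum_abs _ _).trans
    ((Finset.sum_le_sum fun a _ => hbound a).trans ?_)
  rw [hsum]
  have e2 : 1 / ((d + 1)! : ℝ) * (Real.exp 1 ^ m + 1 / 2) + 2 / (Fintype.card K : ℝ)
      + 5 / (Fintype.card K : ℝ) ^ s * (2 - mu d) ^ m = ε + 2 / (Fintype.card K : ℝ) := by
    rw [hε]
    ring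
  rw [e2]
  linarith

end

end VerticalStrips

end

theorem mainTheorem1 {K : Type*} [Field K] [Fintype K] (r s d h : ℕ)
    (hs : 1 < s) (hsr : s < r) (hd : 2 ≤ d)
    (hq : max d 6 < Fintype.card K ^ s)
    (h1 : 1 < h) (hh : h ≤ r - s + 1) :
    (Odd d →
      |VerticalStrips.uniformProb
            {ω : VerticalStrips.Sample K r s d h | VerticalStrips.searchCount ω = (h : ℕ∞)}
          - VerticalStrips.mu d * (1 - VerticalStrips.mu d) ^ (h - 1)|
        ≤ 1 / ((d + 1)! : ℝ) * (Real.exp 1 ^ (h - 1) + 1 / 2)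
          + 2 / (Fintype.card K : ℝ)
          + 5 / (Fintype.card K : ℝ) ^ s * (2 - VerticalStrips.mu d) ^ (h - 1)) ∧
    (Even d →
      |VerticalStrips.uniformProb
            {ω : VerticalStrips.Sample K r s d h | VerticalStrips.searchCount ω = (h : ℕ∞)}
          - VerticalStrips.mu (d + 1) * (1 - VerticalStrips.mu (d + 1)) ^ (h - 1)|
        ≤ 1 / ((d + 1)! : ℝ) * (Real.exp 1 ^ (h - 1) + 1 / 2)
          + 2 / (Fintype.card K : ℝ)
          + 5 / (Fintype.card K : ℝ) ^ s * (2 - VerticalStrips.mu d) ^ (h - 1)) := by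
  obtain ⟨m, rfl⟩ : ∃ m, h = m + 1 := ⟨h - 1, by omega⟩
  have hsucc : VerticalStrips.mu (d + 1)
      = VerticalStrips.mu d + (-1 : ℝ) ^ d / ((d + 1)! : ℝ) := VerticalStrips.mu_succ d
  rw [Nat.add_sub_cancel]
  refine ⟨fun _ => ?_, fun _ => ?_⟩
  · refine VerticalStrips.abs_uniformProb_sub_le hsr hd (by omega) (by omega) ?_
    rw [sub_self, abs_zero]
    positivity
  -- Here μ_d and μ_{d+1} differ by exactly 1/(d+1)! in absolute value, the most that is allowed.
  · refine VerticalStrips.abs_uniformProb_sub_le hsr hd (by omega) (by omega) ?_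
    rw [hsucc, sub_add_cancel_left, abs_neg, abs_div, abs_pow, abs_neg, abs_one, one_pow,
      Nat.abs_cast]
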